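/- Consider an $n$-player general-sum game in normal form, $n \ge 2$, in which player $i \in \{1,\dots,n\}$ has a finite action set $\mathcal A_i$ with $m_i := |\mathcal A_i| \ge 2$ and a utility function $u_i : \mathcal A_1 \times \dots \times \mathcal A_n \to [-1,1]$. At every time $t = 0, 1, 2, \dots$ each player $i$ plays a mixed strategy $x_i^{(t)} \in \Delta(\mathcal A_i)$ and observes the utility vector $u_i^{(t)} \in \mathbb R^{\mathcal A_i}$, where $u_i^{(t)}[a] := \mathbb E_{a_{-i} \sim x_{-i}^{(t)}}[u_i(a, a_{-i})]$ is the expected utility of action $a$ against the strategies of the others. Suppose that every player $i$ runs BM-OFTRL-LogBar with the fixed learning rate $$\eta = \frac{1}{128\,(n-1)\,\max_{j}\sqrt{m_j}},$$ that is: player $i$ maintains, for every action $a \in \mathcal A_i$, distributions $x_{i,a}^{(t)} \in \operatorname{relint} \Delta(\mathcal A_i)$ such that, with the log-barrier $\mathcal R(x) = -\sum_{r \in \mathcal A_i} \log x[r]$ and the utilities $u_{i,a}^{(t)} := x_i^{(t)}[a]\, u_i^{(t)}$, the vector $x_{i,a}^{(0)}$ minimizes $\mathcal R$ over $\operatorname{relint}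 \Delta(\mathcal A_i)$ and, for $t \ge 1$, $$x_{i,a}^{(t)} \in \operatorname*{arg\,max}_{x \in \operatorname{relint} \Delta(\mathcal A_i)} \Big\{ \eta \Big\langle x,\; u_{i,a}^{(t-1)} + \sum_{\tau=1}^{t-1} u_{i,a}^{(\tau)} \Big\rangle - \mathcal R(x) \Big\};$$ and, for every $t \ge 0$, $x_i^{(t)} \in \Delta(\mathcal A_i)$ is a stationary distribution of the row-stochastic matrix $Q_i^{(t)}$ whose row $a$ is $x_{i,a}^{(t)}$, i.e. $(Q_i^{(t)})^\top x_i^{(t)} = x_i^{(t)}$. Then, for every integer $T \ge 2$, $$\sum_{i=1}^n \sum_{t=1}^T \big\| x_i^{(t)} - x_i^{(t-1)} \big\|_1^2 \;\le\; 8192\, \max_{1 \le i \le n} m_i \,\Big(\sum_{i=1}^n m_i^2\Big) \log T .$$ -/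

import Mathlib

open scoped BigOperators Matrix

namespace SwapLearning

/-- A finite `n`-player general-sum game in normal form, with action sets `A i` and
utilities normalized to take values in `[-1, 1]`. -/
structure NormalFormGame (n : ℕ) (A : Fin n → Type*) where
  /-- `utility i a` is the payoff of player `i` under the joint action profile `a`. -/
  utility : Fin n → (∀ j, A j) → ℝ
  utility_mem : ∀ i a, utility i a ∈ Set.Icc (-1 : ℝ) 1

/-- The utility vector that player `i` receives as feedback when the players use the mixed
strategies `x`: its coordinate at an action `a` is the expected utility `u_i(a; x_{-i})`.
The sum runs over all joint profiles `b` with `b i = a`, that is, over all profiles `b_{-i}`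
of the other players, each weighted by `∏_{j ≠ i} x_j[b_j]`. -/
def NormalFormGame.utilityVector {n : ℕ} {A : Fin n → Type*} [∀ j, Fintype (A j)]
    [∀ j, DecidableEq (A j)] (G : NormalFormGame n A) (x : ∀ j, A j → ℝ) (i : Fin n) :
    A i → ℝ :=
  fun a => ∑ b : (∀ j, A j) with b i = a,
    G.utility i b * ∏ j ∈ Finset.univ.erase i, x j (b j)

section SinglePlayer

variable {A : Type*} [Fintype A]

/-- The relative interior of the probability simplex: probability vectors with full support.
The log-barrier is finite exactly at these points of the simplex. -/
def openSimplex (A : Type*) [Fintype A] : Set (A → ℝ) :=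
  {x | x ∈ stdSimplex ℝ A ∧ ∀ r, 0 < x r}

/-- The log-barrier regularizer `R(x) = -∑ r, log x[r]` on the simplex. -/
noncomputable def logBarrier (x : A → ℝ) : ℝ := -∑ r, Real.log (x r)

/-- The sequence `x^(0), x^(1), …` is produced by optimistic follow the regularized leader
(OFTRL) over the probability simplex with log-barrier regularization and the fixed learning
rate `η`, on the sequence of utility vectors `u^(0), u^(1), …`, with predictions
`m^(t) = u^(t-1)`:
`x^(0)` minimizes `R`, and, for `t ≥ 1`,
`x^(t)` maximizes `η ⟨x, m^(t) + ∑_{τ=1}^{t-1} u^(τ)⟩ - R(x)`.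
As `R = +∞` on the relative boundary of the simplex, the optimization is over its
relative interior. -/
structure IsOFTRLLogBar (η : ℝ) (u x : ℕ → A → ℝ) : Prop where
  zero_mem : x 0 ∈ openSimplex A
  zero_isMinOn : IsMinOn logBarrier (openSimplex A) (x 0)
  mem : ∀ t, 1 ≤ t → x t ∈ openSimplex A
  isMaxOn : ∀ t, 1 ≤ t → IsMaxOn
    (fun y : A → ℝ => η * (y ⬝ᵥ (u (t - 1) + ∑ τ ∈ Finset.Ico 1 t, u τ)) - logBarrier y)
    (openSimplex A) (x t)

/-- The sequence of strategies `x^(0), x^(1), …` is produced by the Blum–Mansour algorithm in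
which the external regret minimizer of every action is OFTRL with log-barrier regularization
and learning rate `η`, on the sequence of utility vectors `u^(0), u^(1), …`.
Row `a` of the stochastic matrix `Q^(t)` is the `t`-th strategy of the regret minimizer
`R_a`, which is fed with the utilities `x^(t)[a] u^(t)`, and `x^(t)` is a stationary
distribution of `Q^(t)`. -/
def IsBMOFTRLLogBar (η : ℝ) (u x : ℕ → A → ℝ) : Prop :=
  ∃ Q : ℕ → Matrix A A ℝ,
    (∀ a, IsOFTRLLogBar η (fun t => x t a • u t) (fun t => Q t a)) ∧
    ∀ t, x t ∈ stdSimplex ℝ A ∧ (Q t)ᵀ *ᵥ x t = x t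

/-- The `ℓ₁` norm of a vector. -/
def l1Norm (v : A → ℝ) : ℝ := ∑ a, |v a|

end SinglePlayer

/-- All players of the game `G` employ BM-OFTRL-LogBar with learning rate `η`; `x t i` is the
mixed strategy of player `i` at time `t`, and each player observes only the own utility
vectors induced by the strategies of the other players. -/
def IsBMOFTRLLogBarDynamics {n : ℕ} {A : Fin n → Type*} [∀ j, Fintype (A j)]
    [∀ j, DecidableEq (A j)] (G : NormalFormGame n A) (η : ℝ)
    (x : ℕ → ∀ j, A j → ℝ) : Prop :=
  ∀ i, IsBMOFTRLLogBar η (fun t => G.utilityVector (x t) i) (fun t => x t i)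

end SwapLearning

/-! Swap regret against the identity deviation is zero, so it cannot be very negative, whereas the
optimistic regret bound contains a negative sum of Bregman divergences between consecutive iterates.
Comparing the two bounds the movement of the dynamics.

For each row, `IsOFTRLLogBar.sum_logBarrierDiv_le` bounds the summed divergences by a barrier cost,
minus the regret, plus inner products of strategy changes with utility changes. With comparators
near the vertices, the barrier costs `m log T` per row, and stationarity makes the regrets of all
rows sum to at least a constant (`neg_two_mul_le_sum_mix`). AM-GM moves half of the divergences to
the left and leaves squared utility variations times `η ^ 2`.

The divergences in turn control the played strategies: small log-ratios in the rows give small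
log-ratios in the stationary distribution, whatever the mixing time (`stationary_le_exp_mul`),
whence `l1Norm_sub_sq_le`. A player's utilities vary by at most the total movement of all players
(`NormalFormGame.abs_utilityVector_sub_le`), so after summing over players the same path length
stands on both sides; `η` makes its coefficient on the right less than one. -/

namespace SwapLearning

/-! ### Log-barrier OFTRL: optimality, multiplicative stability, regret identity. -/

section LogBarrier

variable {A : Type*}

/-- The aggregate utility vector to which optimistic FTRL responds at time `t`. -/
def optimisticAggregate (u : ℕ → A → ℝ) (t : ℕ) : A → ℝ :=
  if t = 0 then 0 else u (t - 1) + ∑ τ ∈ Finset.Ico 1 t, u τ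

theorem optimisticAggregate_zero (u : ℕ → A → ℝ) : optimisticAggregate u 0 = 0 := by
  simp [optimisticAggregate]

theorem optimisticAggregate_one (u : ℕ → A → ℝ) : optimisticAggregate u 1 = u 0 := by
  simp [optimisticAggregate]

theorem optimisticAggregate_add_two (u : ℕ → A → ℝ) (t : ℕ) :
    optimisticAggregate u (t + 2) =
      optimisticAggregate u (t + 1) + u (t + 1) + (u (t + 1) - u t) := by
  simp only [optimisticAggregate, Nat.add_eq_zero_iff, OfNat.ofNat_ne_zero, and_false, if_false,
    one_ne_zero, Nat.add_sub_cancel, show t + 2 - 1 = t + 1 by omega]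
  rw [show t + 2 = (t + 1) + 1 by ring, Finset.sum_Ico_succ_top (by omega)]
  abel

variable [Fintype A]

theorem openSimplex.le_one {x : A → ℝ} (hx : x ∈ openSimplex A) (r : A) : x r ≤ 1 := by
  rw [← hx.1.2]
  exact Finset.single_le_sum (fun s _ => (hx.2 s).le) (Finset.mem_univ r)

/-- First-order optimality of `x` on the open simplex for the objective
`η ⟨x, L⟩ - R(x)`, with `R` the log-barrier. -/
structure IsLogBarrierLeader (η : ℝ) (L x : A → ℝ) : Prop where
  mem : x ∈ openSimplex A
  stationary : ∀ r s, (x r)⁻¹ + η * L r = (x s)⁻¹ + η * L s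

/-- Shifting a little mass between `s` and `r`, in either direction, stays in the open simplex, so
the derivative along this direction vanishes. -/
theorem isLogBarrierLeader_of_isMaxOn {η : ℝ} {L x : A → ℝ} (hx : x ∈ openSimplex A)
    (hmax : IsMaxOn (fun y : A → ℝ => η * (y ⬝ᵥ L) - logBarrier y) (openSimplex A) x) :
    IsLogBarrierLeader η L x := by
  classical
  refine ⟨hx, fun r s => ?_⟩
  by_cases hrs : r = s
  · rw [hrs]
  set v : A → ℝ := Pi.single r 1 - Pi.single s 1 with hv
  have hvsum : ∑ c, v c = 0 := by simp [hv]
  set F : ℝ → ℝ := fun h => η * ((x + h • v) ⬝ᵥ L) - logBarrier (x + h • v) with hF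
  have hmem : ∀ᶠ h in nhds (0 : ℝ), x + h • v ∈ openSimplex A := by
    have hpos : ∀ᶠ h in nhds (0 : ℝ), ∀ c, 0 < x c + h * v c := by
      rw [Filter.eventually_all]
      intro c
      have : ContinuousAt (fun h : ℝ => x c + h * v c) 0 := by fun_prop
      exact this.eventually (lt_mem_nhds (by simpa using hx.2 c))
    filter_upwards [hpos] with h hh
    refine ⟨⟨fun c => (hh c).le, ?_⟩, hh⟩
    simp [Finset.sum_add_distrib, ← Finset.mul_sum, hvsum, hx.1.2]
  have hloc : IsLocalMax F 0 := by
    filter_upwards [hmem] with h hh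
    simpa [hF] using hmax hh
  have hderiv : HasDerivAt F (η * ∑ c, v c * L c + ∑ c, v c / x c) 0 := by
    have h1 : HasDerivAt (fun h : ℝ => η * ∑ c, (x c + h * v c) * L c)
        (η * ∑ c, v c * L c) 0 := by
      refine HasDerivAt.const_mul _ (HasDerivAt.fun_sum fun c _ => ?_)
      have := (((hasDerivAt_id (0 : ℝ)).mul_const (v c)).const_add (x c)).mul_const (L c)
      simpa using this
    have h2 : HasDerivAt (fun h : ℝ => ∑ c, Real.log (x c + h * v c)) (∑ c, v c / x c) 0 := by
      refine HasDerivAt.fun_sum fun c _ => ?_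
      have := (((hasDerivAt_id (0 : ℝ)).mul_const (v c)).const_add (x c)).log
        (by simpa using (hx.2 c).ne')
      simpa using this
    have := h1.add h2
    refine this.congr_of_eventuallyEq (Filter.Eventually.of_forall fun h => ?_)
    simp [hF, logBarrier, dotProduct]
  have h0 := hloc.hasDerivAt_eq_zero hderiv
  have h1 : ∑ c, v c * L c = L r - L s := by
    simp [hv, sub_mul, Finset.sum_sub_distrib, Pi.single_apply]
  have h2 : ∑ c, v c / x c = (x r)⁻¹ - (x s)⁻¹ := by
    simp [hv, sub_div, Finset.sum_sub_distrib, Pi.single_apply, ite_div]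
  rw [h1, h2] at h0
  linarith

theorem IsOFTRLLogBar.isLogBarrierLeader {η : ℝ} {u x : ℕ → A → ℝ} (h : IsOFTRLLogBar η u x)
    (t : ℕ) : IsLogBarrierLeader η (optimisticAggregate u t) (x t) := by
  rcases Nat.eq_zero_or_pos t with rfl | ht
  · rw [optimisticAggregate_zero]
    refine isLogBarrierLeader_of_isMaxOn h.zero_mem fun y hy => ?_
    simpa using h.zero_isMinOn hy
  · have := isLogBarrierLeader_of_isMaxOn (h.mem t ht) (h.isMaxOn t ht)
    rwa [optimisticAggregate, if_neg ht.ne']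

theorem abs_log_le_two_mul {z d : ℝ} (hz : |z - 1| ≤ d) (hd : d ≤ 1 / 2) :
    |Real.log z| ≤ 2 * d := by
  have h := abs_le.1 hz
  have hz0 : 0 < z := by linarith
  have h1 := Real.log_le_sub_one_of_pos hz0
  have h2 := Real.one_sub_inv_le_log_of_pos hz0
  have h3 : z⁻¹ ≤ 1 + 2 * d := by
    rw [inv_le_comm₀ hz0 (by linarith), inv_le_iff_one_le_mul₀ (by linarith)]
    nlinarith
  exact abs_le.2 ⟨by linarith, by linarith⟩

/-- Stationarity makes the changes of the inverse coordinates differ by at most `2 * δ` from one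
another. Both points have total mass one, so some inverse does not increase and some does not
decrease; hence every change is at most `2 * δ`, which is a relative bound since coordinates are at
most one. -/
theorem IsLogBarrierLeader.abs_log_div_le {η δ : ℝ} {L L' x x' : A → ℝ}
    (h : IsLogBarrierLeader η L x) (h' : IsLogBarrierLeader η L' x')
    (hδ : ∀ r, |η * (L' r - L r)| ≤ δ) (hδ' : δ ≤ 1 / 4) (r : A) :
    |Real.log (x' r / x r)| ≤ 4 * δ := by
  have hx := h.mem.2
  have hx' := h'.mem.2
  have key : ∀ s, (x' r)⁻¹ - (x r)⁻¹ - ((x' s)⁻¹ - (x s)⁻¹) =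
      η * (L' s - L s) - η * (L' r - L r) := fun s => by
    have := h.stationary r s
    have := h'.stationary r s
    linarith
  have hsum : ∑ c, x' c = ∑ c, x c := by rw [h.mem.1.2, h'.mem.1.2]
  obtain ⟨s, hs⟩ : ∃ s, (x' s)⁻¹ - (x s)⁻¹ ≤ 0 := by
    by_contra! hcon
    refine absurd hsum (Finset.sum_lt_sum_of_nonempty ⟨r, Finset.mem_univ r⟩ fun c _ => ?_).ne
    have := hcon c
    rw [sub_pos, inv_lt_inv₀ (hx c) (hx' c)] at this
    exact this
  obtain ⟨s', hs'⟩ : ∃ s, 0 ≤ (x' s)⁻¹ - (x s)⁻¹ := by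
    by_contra! hcon
    refine absurd hsum (Finset.sum_lt_sum_of_nonempty ⟨r, Finset.mem_univ r⟩ fun c _ => ?_).ne'
    have := hcon c
    rw [sub_neg, inv_lt_inv₀ (hx' c) (hx c)] at this
    exact this
  have hinv : |(x' r)⁻¹ - (x r)⁻¹| ≤ 2 * δ := by
    have h1 := abs_le.1 (hδ r)
    have h2 := abs_le.1 (hδ s)
    have h3 := abs_le.1 (hδ s')
    have h4 := key s
    have h5 := key s'
    exact abs_le.2 ⟨by linarith, by linarith⟩
  have hz : |x r / x' r - 1| ≤ 2 * δ := by
    have : x r / x' r - 1 = x r * ((x' r)⁻¹ - (x r)⁻¹) := by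
      have := (hx r).ne'
      field_simp
    rw [this, abs_mul, abs_of_pos (hx r)]
    calc x r * |(x' r)⁻¹ - (x r)⁻¹| ≤ 1 * (2 * δ) :=
          mul_le_mul (openSimplex.le_one h.mem r) hinv (abs_nonneg _) zero_le_one
      _ = 2 * δ := one_mul _
  rw [← inv_div, Real.log_inv, abs_neg]
  linarith [abs_log_le_two_mul hz (by linarith)]

/-- The Bregman divergence of the log-barrier. -/
noncomputable def logBarrierDiv (y x : A → ℝ) : ℝ :=
  ∑ r, (y r / x r - 1 - Real.log (y r / x r))

theorem logBarrierDiv_nonneg {x y : A → ℝ} (hx : x ∈ openSimplex A) (hy : y ∈ openSimplex A) :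
    0 ≤ logBarrierDiv y x :=
  Finset.sum_nonneg fun r _ => by
    linarith [Real.log_le_sub_one_of_pos (div_pos (hy.2 r) (hx.2 r))]

/-- The Taylor remainder is at most `2/9 * |s| ^ 3`, and `1/2 - 2/9` exceeds `1/4`. -/
theorem sq_le_four_mul_exp_sub {s : ℝ} (hs : |s| ≤ 1) : s ^ 2 ≤ 4 * (Real.exp s - 1 - s) := by
  have h := Real.exp_bound hs (n := 3) (by norm_num)
  norm_num [Finset.sum_range_succ, Nat.factorial] at h
  have h1 := (abs_le.1 h).1
  have h2 : |s| ^ 3 ≤ s ^ 2 := by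
    rw [← sq_abs s]
    nlinarith [abs_nonneg s, sq_nonneg |s|]
  nlinarith

theorem sq_log_div_le {x y : A → ℝ} (hx : x ∈ openSimplex A) (hy : y ∈ openSimplex A) {r : A}
    (hr : |Real.log (y r / x r)| ≤ 1) :
    Real.log (y r / x r) ^ 2 ≤ 4 * logBarrierDiv y x := by
  have hpos : 0 < y r / x r := div_pos (hy.2 r) (hx.2 r)
  have h1 := sq_le_four_mul_exp_sub hr
  rw [Real.exp_log hpos] at h1
  have h2 : y r / x r - 1 - Real.log (y r / x r) ≤ logBarrierDiv y x :=
    Finset.single_le_sum (f := fun r => y r / x r - 1 - Real.log (y r / x r))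
      (fun s _ => by linarith [Real.log_le_sub_one_of_pos (div_pos (hy.2 s) (hx.2 s))])
      (Finset.mem_univ r)
  linarith

/-- An equality, not just an inequality: at an interior leader the gradient of the objective is a
constant vector, which is orthogonal to differences of simplex points. -/
theorem IsLogBarrierLeader.objective_eq {η : ℝ} {L x y : A → ℝ} (h : IsLogBarrierLeader η L x)
    (hy : y ∈ openSimplex A) :
    logBarrier y - η * (y ⬝ᵥ L) = logBarrier x - η * (x ⬝ᵥ L) + logBarrierDiv y x := by
  have hne : Nonempty A := by
    by_contra hcon
    rw [not_nonempty_iff] at hcon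
    simpa using hy.1.2
  obtain ⟨s⟩ := hne
  set c := (x s)⁻¹ + η * L s
  have hc : ∀ r, η * L r = c - (x r)⁻¹ := fun r => by linarith [h.stationary r s]
  have h1 : ∀ z : A → ℝ, z ∈ openSimplex A → η * (z ⬝ᵥ L) = c - ∑ r, z r / x r := by
    intro z hz
    have : ∀ r, η * (z r * L r) = c * z r - z r / x r := fun r => by
      rw [mul_left_comm, hc]; ring
    rw [dotProduct, Finset.mul_sum, Finset.sum_congr rfl fun r _ => this r,
      Finset.sum_sub_distrib, ← Finset.mul_sum, hz.1.2, mul_one]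
  rw [h1 y hy, h1 x h.mem, logBarrierDiv, logBarrier, logBarrier]
  have h2 : ∑ r, (y r / x r - 1 - Real.log (y r / x r)) =
      ∑ r, y r / x r - ∑ r, x r / x r - (∑ r, Real.log (y r) - ∑ r, Real.log (x r)) := by
    simp only [← Finset.sum_sub_distrib]
    refine Finset.sum_congr rfl fun r _ => ?_
    rw [Real.log_div (hy.2 r).ne' (h.mem.2 r).ne', div_self (h.mem.2 r).ne']
  rw [h2]
  ring

/-- Telescoping of `objective_eq` between consecutive iterates. The terms in `y` cancel; they are
inserted to exhibit the regret against `y`. -/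
theorem IsOFTRLLogBar.sum_logBarrierDiv_eq {η : ℝ} {u x : ℕ → A → ℝ} (h : IsOFTRLLogBar η u x)
    (y : A → ℝ) (k : ℕ) :
    ∑ t ∈ Finset.range (k + 1), logBarrierDiv (x (t + 1)) (x t) =
      logBarrier (x (k + 1)) - η * (x (k + 1) ⬝ᵥ optimisticAggregate u (k + 1))
        + η * (y ⬝ᵥ optimisticAggregate u (k + 1)) - logBarrier (x 0)
        - η * ∑ t ∈ Finset.range k, (y - x (t + 1)) ⬝ᵥ u (t + 1)
        - η * ((y - x (k + 1)) ⬝ᵥ u k)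
        + η * ∑ t ∈ Finset.range k, (x (t + 2) - x (t + 1)) ⬝ᵥ (u (t + 1) - u t) := by
  have hmem : ∀ t, x t ∈ openSimplex A := fun t => (h.isLogBarrierLeader t).mem
  induction k with
  | zero =>
    have := (h.isLogBarrierLeader 0).objective_eq (hmem 1)
    simp only [optimisticAggregate_zero, dotProduct_zero] at this
    simp only [zero_add, Finset.sum_range_one, optimisticAggregate_one, Finset.range_zero,
      Finset.sum_empty, sub_dotProduct]
    linarith
  | succ k ih =>
    have := (h.isLogBarrierLeader (k + 1)).objective_eq (hmem (k + 2))
    rw [Finset.sum_range_succ, ih, Finset.sum_range_succ _ k, Finset.sum_range_succ _ k,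
      show k + 1 + 1 = k + 2 by ring, optimisticAggregate_add_two]
    simp only [sub_dotProduct, dotProduct_sub, dotProduct_add] at this ⊢
    linarith

theorem IsOFTRLLogBar.sum_logBarrierDiv_le {η : ℝ} {u x : ℕ → A → ℝ} (h : IsOFTRLLogBar η u x)
    {y : A → ℝ} (hy : y ∈ openSimplex A) (k : ℕ) :
    ∑ t ∈ Finset.range (k + 1), logBarrierDiv (x (t + 1)) (x t) ≤
      logBarrier y - logBarrier (x 0)
        - η * ∑ t ∈ Finset.range k, (y - x (t + 1)) ⬝ᵥ u (t + 1)
        - η * ((y - x (k + 1)) ⬝ᵥ u k)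
        + η * ∑ t ∈ Finset.range k, (x (t + 2) - x (t + 1)) ⬝ᵥ (u (t + 1) - u t) := by
  have h1 := (h.isLogBarrierLeader (k + 1)).objective_eq hy
  have h2 := logBarrierDiv_nonneg (h.isLogBarrierLeader (k + 1)).mem hy
  rw [h.sum_logBarrierDiv_eq y k]
  linarith

end LogBarrier

/-! ### Multiplicative perturbation of stationary distributions. -/

section StationaryDistribution

variable {A : Type*} [Fintype A]

/-- `1 - Q` kills the all-ones vector, so it has a left null vector `v`. Entrywise `|v| ≤ |v| Q`,
and both sides have equal mass, so `|v|` is stationary after normalization. -/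
theorem exists_stationary_of_stochastic [Nonempty A] {Q : Matrix A A ℝ}
    (hQ : ∀ b, Q b ∈ stdSimplex ℝ A) : ∃ p ∈ stdSimplex ℝ A, Qᵀ *ᵥ p = p := by
  classical
  have hdet : (1 - Q).det = 0 := by
    refine Matrix.exists_mulVec_eq_zero_iff.1 ⟨1, one_ne_zero, ?_⟩
    ext b
    rw [Matrix.sub_mulVec, Matrix.one_mulVec]
    simp [Matrix.mulVec, dotProduct, (hQ b).2]
  obtain ⟨v, hv0, hv⟩ := Matrix.exists_vecMul_eq_zero_iff.2 hdet
  have hv' : ∀ c, v c = ∑ b, v b * Q b c := fun c => by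
    have := congrFun hv c
    simp only [Matrix.vecMul_sub, Matrix.vecMul_one, Pi.sub_apply, Pi.zero_apply] at this
    simpa [Matrix.vecMul, dotProduct] using sub_eq_zero.1 this
  have hle : ∀ c, |v c| ≤ ∑ b, |v b| * Q b c := fun c => by
    conv_lhs => rw [hv' c]
    refine (Finset.abs_sum_le_sum_abs _ _).trans (Finset.sum_le_sum fun b _ => ?_)
    rw [abs_mul, abs_of_nonneg ((hQ b).1 c)]
  have htot : ∑ c, ∑ b, |v b| * Q b c = ∑ c, |v c| := by
    rw [Finset.sum_comm]
    exact Finset.sum_congr rfl fun b _ => by rw [← Finset.mul_sum, (hQ b).2, mul_one]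
  have heq : ∀ c, |v c| = ∑ b, |v b| * Q b c := fun c =>
    (Finset.sum_eq_sum_iff_of_le fun c _ => hle c).1 htot.symm c (Finset.mem_univ c)
  have hpos : 0 < ∑ c, |v c| := by
    obtain ⟨c, hc⟩ := Function.ne_iff.1 hv0
    exact Finset.sum_pos' (fun _ _ => abs_nonneg _) ⟨c, Finset.mem_univ c, abs_pos.2 hc⟩
  refine ⟨fun c => |v c| / ∑ c, |v c|, ⟨fun c => by positivity, ?_⟩, ?_⟩
  · rw [← Finset.sum_div, div_self hpos.ne']
  · ext c
    simp only [Matrix.mulVec, dotProduct, Matrix.transpose_apply]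
    rw [heq c, Finset.sum_div]
    exact Finset.sum_congr rfl fun b _ => by ring

theorem stationary_apply {Q : Matrix A A ℝ} {p : A → ℝ} (hp : Qᵀ *ᵥ p = p) (c : A) :
    p c = ∑ b, p b * Q b c := by
  conv_lhs => rw [← hp]
  simp only [Matrix.mulVec, dotProduct, Matrix.transpose_apply]
  exact Finset.sum_congr rfl fun b _ => mul_comm _ _

theorem stationary_pos {Q : Matrix A A ℝ} (hQ : ∀ b, Q b ∈ openSimplex A) {p : A → ℝ}
    (hp : p ∈ stdSimplex ℝ A) (hQp : Qᵀ *ᵥ p = p) (c : A) : 0 < p c := by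
  rw [stationary_apply hQp]
  obtain ⟨b, hb⟩ : ∃ b, 0 < p b := by
    by_contra! hcon
    have := hp.2 ▸ Finset.sum_nonpos fun b (_ : b ∈ Finset.univ) => hcon b
    linarith
  exact Finset.sum_pos' (fun b _ => mul_nonneg (hp.1 b) ((hQ b).2 c).le)
    ⟨b, Finset.mem_univ b, mul_pos hb ((hQ b).2 c)⟩

/-- If two stochastic matrices with positive entries agree outside row `b`, and row `b` of the
second is at most `κ ≥ 1` times that of the first, then the stationary distributions, normalized
to `1` at `b`, satisfy the same bound. -/
theorem stationary_mul_le_of_row_le {Q Q' : Matrix A A ℝ} (hQ : ∀ b, Q b ∈ openSimplex A)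
    {p p' : A → ℝ} (hp : p ∈ stdSimplex ℝ A)
    (hQp : Qᵀ *ᵥ p = p) (hp' : p' ∈ stdSimplex ℝ A) (hQp' : Q'ᵀ *ᵥ p' = p') {b : A}
    (hrow : ∀ c, c ≠ b → Q' c = Q c) {κ : ℝ} (hκ : 1 ≤ κ) (hle : ∀ c, Q' b c ≤ κ * Q b c)
    (a : A) : p b * p' a ≤ κ * (p' b * p a) := by
  classical
  have hb : 0 ≤ p' b * p b := mul_nonneg (hp'.1 b) (hp.1 b)
  set d : A → ℝ := fun a => κ * (p' b * p a) - p b * p' a with hd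
  have hdb : 0 ≤ d b := by
    simp only [hd]
    nlinarith
  -- Minimum principle: the negative part of `d` satisfies `m ≤ m Q` with equal total mass, hence `m
  -- = m Q`. As `m b = 0` and column `b` is positive, `m` vanishes.
  set m : A → ℝ := fun a => max (-d a) 0 with hm
  have hm0 : ∀ a, 0 ≤ m a := fun a => le_max_right _ _
  have hmb : m b = 0 := max_eq_right (by linarith)
  have hstep : ∀ a, m a ≤ ∑ c, m c * Q c a := by
    intro a
    refine max_le ?_ (Finset.sum_nonneg fun c _ => mul_nonneg (hm0 c) ((hQ c).2 a).le)
    have h1 : -d a = ∑ c, (p b * (p' c * Q' c a) - κ * (p' b * (p c * Q c a))) := by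
      simp only [hd, Finset.sum_sub_distrib, ← Finset.mul_sum]
      rw [← stationary_apply hQp, ← stationary_apply hQp']
      ring
    rw [h1]
    refine Finset.sum_le_sum fun c _ => ?_
    by_cases hc : c = b
    · subst hc
      rw [hmb, zero_mul]
      have := mul_le_mul_of_nonneg_left (hle a) hb
      linarith
    · rw [hrow c hc]
      have : -d c * Q c a ≤ m c * Q c a :=
        mul_le_mul_of_nonneg_right (le_max_left _ _) ((hQ c).2 a).le
      refine le_trans (le_of_eq ?_) this
      simp only [hd]
      ring
  have htot : ∑ a, ∑ c, m c * Q c a = ∑ a, m a := by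
    rw [Finset.sum_comm]
    exact Finset.sum_congr rfl fun c _ => by rw [← Finset.mul_sum, (hQ c).1.2, mul_one]
  have heq := (Finset.sum_eq_sum_iff_of_le fun a _ => hstep a).1 htot.symm b (Finset.mem_univ b)
  rw [hmb] at heq
  have hza := (Finset.sum_eq_zero_iff_of_nonneg
    fun c _ => mul_nonneg (hm0 c) ((hQ c).2 b).le).1 heq.symm a (Finset.mem_univ a)
  have hma : m a = 0 := (mul_eq_zero.1 hza).resolve_right ((hQ a).2 b).ne'
  have : -d a ≤ 0 := hma ▸ le_max_left (-d a) 0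
  simp only [hd] at this
  linarith

/-- One factor `κ` is the comparison normalized at `b`; the other compares `p' b` with `p b`, by
exchanging the two matrices and summing over all states. -/
theorem stationary_le_of_update_row {Q Q' : Matrix A A ℝ} (hQ : ∀ b, Q b ∈ openSimplex A)
    (hQ' : ∀ b, Q' b ∈ openSimplex A) {p p' : A → ℝ} (hp : p ∈ stdSimplex ℝ A)
    (hQp : Qᵀ *ᵥ p = p) (hp' : p' ∈ stdSimplex ℝ A) (hQp' : Q'ᵀ *ᵥ p' = p') {b : A}
    (hrow : ∀ c, c ≠ b → Q' c = Q c) {κ : ℝ} (hκ : 1 ≤ κ) (hle : ∀ c, Q' b c ≤ κ * Q b c)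
    (hle' : ∀ c, Q b c ≤ κ * Q' b c) (a : A) : p' a ≤ κ ^ 2 * p a := by
  have h1 := stationary_mul_le_of_row_le hQ hp hQp hp' hQp' hrow hκ hle a
  have h2 : p' b ≤ κ * p b := by
    have : ∑ a, p' b * p a ≤ ∑ a, κ * (p b * p' a) := Finset.sum_le_sum fun a _ =>
      stationary_mul_le_of_row_le hQ' hp' hQp' hp hQp (fun c hc => (hrow c hc).symm) hκ hle' a
    simpa only [← Finset.mul_sum, hp.2, hp'.2, mul_one] using this
  have hb := stationary_pos hQ hp hQp b
  have ha := stationary_pos hQ hp hQp a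
  refine le_of_mul_le_mul_left ?_ hb
  calc p b * p' a ≤ κ * (p' b * p a) := h1
    _ ≤ κ * (κ * p b * p a) := by gcongr
    _ = p b * (κ ^ 2 * p a) := by ring

/-- Rows are replaced one at a time through hybrid matrices; row `b` costs a factor `exp (2 * l b)`.
-/
theorem stationary_le_exp_mul {Q Q' : Matrix A A ℝ} (hQ : ∀ b, Q b ∈ openSimplex A)
    (hQ' : ∀ b, Q' b ∈ openSimplex A) {p p' : A → ℝ} (hp : p ∈ stdSimplex ℝ A)
    (hQp : Qᵀ *ᵥ p = p) (hp' : p' ∈ stdSimplex ℝ A) (hQp' : Q'ᵀ *ᵥ p' = p') {l : A → ℝ}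
    (hl : ∀ b c, |Real.log (Q' b c / Q b c)| ≤ l b) (a : A) :
    p' a ≤ Real.exp (2 * ∑ b, l b) * p a := by
  classical
  have hl0 : ∀ b, 0 ≤ l b := fun b => (abs_nonneg _).trans (hl b b)
  suffices H : ∀ (S : Finset A) (R : Matrix A A ℝ), (∀ b, R b ∈ openSimplex A) →
      (∀ b ∈ S, R b = Q' b) → (∀ b ∉ S, R b = Q b) → ∀ q ∈ stdSimplex ℝ A, Rᵀ *ᵥ q = q →
      ∀ a, q a ≤ Real.exp (2 * ∑ b ∈ S, l b) * p a from
    H Finset.univ Q' hQ' (fun _ _ => rfl) (fun b hb => absurd (Finset.mem_univ b) hb) p' hp' hQp' a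
  intro S
  induction S using Finset.induction_on with
  | empty =>
    intro R hR _ hRQ q hq hRq a
    obtain rfl : R = Q := by
      ext b c
      rw [hRQ b (Finset.notMem_empty b)]
    -- The base case compares two stationary distributions of one matrix, which is the row update
    -- with `κ = 1`.
    simpa using stationary_le_of_update_row hQ hR hp hQp hq hRq (b := a) (fun _ _ => rfl)
      le_rfl (fun c => by simp) (fun c => by simp) a
  | insert b S hbS ih =>
    intro R hR hRQ' hRQ q hq hRq a
    set R₀ : Matrix A A ℝ := Function.update R b (Q b) with hR₀
    have hR₀b : R₀ b = Q b := Function.update_self _ _ _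
    have hR₀c : ∀ c, c ≠ b → R₀ c = R c := fun c hc => Function.update_of_ne hc _ _
    have hR₀s : ∀ c, R₀ c ∈ openSimplex A := fun c => by
      by_cases hc : c = b
      · rw [hc, hR₀b]; exact hQ b
      · rw [hR₀c c hc]; exact hR c
    have : Nonempty A := ⟨a⟩
    obtain ⟨q₀, hq₀, hRq₀⟩ := exists_stationary_of_stochastic fun c => (hR₀s c).1
    have h1 := ih R₀ hR₀s
      (fun c hc => by
        have hcb : c ≠ b := fun h => hbS (h ▸ hc)
        rw [hR₀c c hcb, hRQ' c (Finset.mem_insert_of_mem hc)])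
      (fun c hc => by
        by_cases hcb : c = b
        · rw [hcb, hR₀b]
        · rw [hR₀c c hcb, hRQ c (by simp [hcb, hc])]) q₀ hq₀ hRq₀ a
    have hRb : R b = Q' b := hRQ' b (Finset.mem_insert_self b S)
    have hlog : ∀ c, Q' b c ≤ Real.exp (l b) * Q b c ∧ Q b c ≤ Real.exp (l b) * Q' b c := by
      intro c
      have h := abs_le.1 (hl b c)
      have hq := (hQ b).2 c
      have hq' := (hQ' b).2 c
      rw [Real.log_div hq'.ne' hq.ne'] at h
      constructor
      · rw [← Real.log_le_log_iff hq' (by positivity),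
          Real.log_mul (Real.exp_ne_zero _) hq.ne', Real.log_exp]
        linarith
      · rw [← Real.log_le_log_iff hq (by positivity),
          Real.log_mul (Real.exp_ne_zero _) hq'.ne', Real.log_exp]
        linarith
    have h2 := stationary_le_of_update_row hR₀s hR hq₀ hRq₀ hq hRq (b := b)
      (fun c hc => (hR₀c c hc).symm) (Real.one_le_exp (hl0 b))
      (fun c => by rw [hRb, hR₀b]; exact (hlog c).1)
      (fun c => by rw [hRb, hR₀b]; exact (hlog c).2) a
    calc q a ≤ Real.exp (l b) ^ 2 * q₀ a := h2
      _ ≤ Real.exp (l b) ^ 2 * (Real.exp (2 * ∑ b ∈ S, l b) * p a) := by gcongr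
      _ = Real.exp (2 * ∑ b ∈ insert b S, l b) * p a := by
        rw [Finset.sum_insert hbS, mul_add, Real.exp_add, ← Real.exp_nat_mul]
        push_cast
        ring

theorem l1Norm_stationary_sub_le {Q Q' : Matrix A A ℝ} (hQ : ∀ b, Q b ∈ openSimplex A)
    (hQ' : ∀ b, Q' b ∈ openSimplex A) {p p' : A → ℝ} (hp : p ∈ stdSimplex ℝ A)
    (hQp : Qᵀ *ᵥ p = p) (hp' : p' ∈ stdSimplex ℝ A) (hQp' : Q'ᵀ *ᵥ p' = p') {l : A → ℝ}
    (hl : ∀ b c, |Real.log (Q' b c / Q b c)| ≤ l b) (hl1 : 2 * ∑ b, l b ≤ 1) :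
    l1Norm (p' - p) ≤ 4 * ∑ b, l b := by
  have hl0 : 0 ≤ ∑ b, l b := Finset.sum_nonneg fun b _ => (abs_nonneg _).trans (hl b b)
  set E := Real.exp (2 * ∑ b, l b) with hE
  have hE1 : 1 ≤ E := Real.one_le_exp (by linarith)
  have hE2 : E - 1 ≤ 4 * ∑ b, l b := by
    have := Real.abs_exp_sub_one_le (x := 2 * ∑ b, l b) (by rwa [abs_of_nonneg (by linarith)])
    rw [abs_of_nonneg (a := 2 * ∑ b, l b) (by linarith)] at this
    linarith [le_abs_self (E - 1)]
  have h : ∀ a, |p' a - p a| ≤ (E - 1) * p a := by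
    intro a
    have h1 := stationary_le_exp_mul hQ hQ' hp hQp hp' hQp' hl a
    have h2 := stationary_le_exp_mul hQ' hQ hp' hQp' hp hQp (l := l)
      (fun b c => by rw [← inv_div, Real.log_inv, abs_neg]; exact hl b c) a
    rw [← hE] at h1 h2
    have hpa := hp.1 a
    have hpa' := hp'.1 a
    refine abs_le.2 ⟨?_, by linarith⟩
    by_cases hc : p a ≤ p' a
    · nlinarith
    · nlinarith
  calc l1Norm (p' - p) ≤ ∑ a, (E - 1) * p a := Finset.sum_le_sum fun a _ => h a
    _ = E - 1 := by rw [← Finset.mul_sum, hp.2, mul_one]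
    _ ≤ _ := hE2

end StationaryDistribution

/-! ### Lipschitz dependence of the utilities on the strategies. -/

section Utility

variable {n : ℕ} {A : Fin n → Type*}

theorem NormalFormGame.abs_utility_le_one (G : NormalFormGame n A) (i : Fin n) (b : ∀ j, A j) :
    |G.utility i b| ≤ 1 := abs_le.2 (G.utility_mem i b)

variable [∀ j, Fintype (A j)]

theorem sum_prod_eq_prod_sum (f : ∀ j, A j → ℝ) :
    ∑ b : (∀ j, A j), ∏ j, f j (b j) = ∏ j, ∑ c, f j c := by
  rw [Finset.prod_univ_sum, Fintype.piFinset_univ]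

/-- Hybrid argument: switching the single factor `i` leaves a product of `|p i - q i|` with
probability vectors, whose sum over profiles factorizes. -/
theorem sum_abs_prod_sub_prod_le {p q : ∀ j, A j → ℝ} (hp : ∀ j, p j ∈ stdSimplex ℝ (A j))
    (hq : ∀ j, q j ∈ stdSimplex ℝ (A j)) :
    ∑ b : (∀ j, A j), |∏ j, p j (b j) - ∏ j, q j (b j)| ≤ ∑ j, l1Norm (p j - q j) := by
  suffices H : ∀ S : Finset (Fin n),
      ∑ b : (∀ j, A j), |∏ j, (if j ∈ S then p j else q j) (b j) - ∏ j, q j (b j)| ≤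
        ∑ j ∈ S, l1Norm (p j - q j) by
    simpa using H Finset.univ
  intro S
  induction S using Finset.induction_on with
  | empty => simp
  | insert i S hi ih =>
    rw [Finset.sum_insert hi]
    have hstep : ∑ b : (∀ j, A j), |∏ j, (if j ∈ insert i S then p j else q j) (b j) -
        ∏ j, (if j ∈ S then p j else q j) (b j)| = l1Norm (p i - q i) := by
      have h1 : ∀ b : (∀ j, A j), |∏ j, (if j ∈ insert i S then p j else q j) (b j) -
          ∏ j, (if j ∈ S then p j else q j) (b j)| =
          ∏ j, (if j = i then fun c => |p j c - q j c| else if j ∈ S then p j else q j) (b j) := by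
        intro b
        rw [← Finset.mul_prod_erase _ _ (Finset.mem_univ i),
          ← Finset.mul_prod_erase _ _ (Finset.mem_univ i),
          ← Finset.mul_prod_erase _ _ (Finset.mem_univ i)]
        have h2 : ∏ j ∈ Finset.univ.erase i, (if j ∈ insert i S then p j else q j) (b j) =
            ∏ j ∈ Finset.univ.erase i, (if j ∈ S then p j else q j) (b j) :=
          Finset.prod_congr rfl fun j hj => by
            simp [Finset.mem_insert, Finset.ne_of_mem_erase hj]
        have h3 : ∏ j ∈ Finset.univ.erase i, (if j = i then fun c => |p j c - q j c|
              else if j ∈ S then p j else q j) (b j) =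
            ∏ j ∈ Finset.univ.erase i, (if j ∈ S then p j else q j) (b j) :=
          Finset.prod_congr rfl fun j hj => by simp [Finset.ne_of_mem_erase hj]
        rw [h2, h3, ← sub_mul, abs_mul]
        simp only [Finset.mem_insert_self, if_true, hi, if_false]
        congr 1
        refine abs_of_nonneg (Finset.prod_nonneg fun j _ => ?_)
        split_ifs
        · exact (hp j).1 _
        · exact (hq j).1 _
      rw [Finset.sum_congr rfl fun b _ => h1 b, sum_prod_eq_prod_sum,
        ← Finset.mul_prod_erase _ _ (Finset.mem_univ i), Finset.prod_eq_one, mul_one]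
      · simp [l1Norm]
      · intro j hj
        rw [if_neg (Finset.ne_of_mem_erase hj)]
        split_ifs
        · exact (hp j).2
        · exact (hq j).2
    calc _ ≤ ∑ b : (∀ j, A j), (|∏ j, (if j ∈ insert i S then p j else q j) (b j) -
            ∏ j, (if j ∈ S then p j else q j) (b j)| +
          |∏ j, (if j ∈ S then p j else q j) (b j) - ∏ j, q j (b j)|) :=
          Finset.sum_le_sum fun b _ => abs_sub_le _ _ _
      _ ≤ _ := by
        rw [Finset.sum_add_distrib, hstep]
        gcongr

variable [∀ j, DecidableEq (A j)]

/-- The expected utility of the pure action `a`, as a sum over all profiles. -/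
theorem NormalFormGame.utilityVector_eq (G : NormalFormGame n A) (x : ∀ j, A j → ℝ) (i : Fin n)
    (a : A i) : G.utilityVector x i a =
      ∑ b : (∀ j, A j), G.utility i b * ∏ j, Function.update x i (Pi.single a 1) j (b j) := by
  rw [NormalFormGame.utilityVector, Finset.sum_filter]
  refine Finset.sum_congr rfl fun b _ => ?_
  rw [← Finset.mul_prod_erase _ _ (Finset.mem_univ i), Function.update_self, Pi.single_apply]
  have : ∏ j ∈ Finset.univ.erase i, Function.update x i (Pi.single a 1) j (b j) =
      ∏ j ∈ Finset.univ.erase i, x j (b j) :=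
    Finset.prod_congr rfl fun j hj => by rw [Function.update_of_ne (Finset.ne_of_mem_erase hj)]
  rw [this]
  split_ifs <;> simp

theorem update_single_mem_stdSimplex {x : ∀ j, A j → ℝ} (hx : ∀ j, x j ∈ stdSimplex ℝ (A j))
    (i : Fin n) (a : A i) (j : Fin n) :
    Function.update x i (Pi.single a 1) j ∈ stdSimplex ℝ (A j) := by
  by_cases h : j = i
  · subst h
    rw [Function.update_self]
    exact single_mem_stdSimplex ℝ a
  · rw [Function.update_of_ne h]
    exact hx j

theorem NormalFormGame.abs_utilityVector_le_one (G : NormalFormGame n A) {x : ∀ j, A j → ℝ}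
    (hx : ∀ j, x j ∈ stdSimplex ℝ (A j)) (i : Fin n) (a : A i) :
    |G.utilityVector x i a| ≤ 1 := by
  rw [G.utilityVector_eq]
  have hy := update_single_mem_stdSimplex hx i a
  generalize Function.update x i (Pi.single a 1) = y at hy
  calc |∑ b, G.utility i b * ∏ j, y j (b j)| ≤ ∑ b : (∀ j, A j), ∏ j, y j (b j) := by
        refine (Finset.abs_sum_le_sum_abs _ _).trans (Finset.sum_le_sum fun b _ => ?_)
        have h0 : 0 ≤ ∏ j, y j (b j) := Finset.prod_nonneg fun j _ => (hy j).1 _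
        rw [abs_mul, abs_of_nonneg h0]
        exact mul_le_of_le_one_left h0 (G.abs_utility_le_one i b)
    _ = 1 := by
        rw [sum_prod_eq_prod_sum]
        exact Finset.prod_eq_one fun j _ => (hy j).2

theorem NormalFormGame.abs_utilityVector_sub_le (G : NormalFormGame n A) {x y : ∀ j, A j → ℝ}
    (hx : ∀ j, x j ∈ stdSimplex ℝ (A j)) (hy : ∀ j, y j ∈ stdSimplex ℝ (A j)) (i : Fin n)
    (a : A i) :
    |G.utilityVector x i a - G.utilityVector y i a| ≤ ∑ j, l1Norm (x j - y j) := by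
  rw [G.utilityVector_eq, G.utilityVector_eq, ← Finset.sum_sub_distrib]
  calc _ ≤ ∑ b : (∀ j, A j), |∏ j, Function.update x i (Pi.single a 1) j (b j) -
          ∏ j, Function.update y i (Pi.single a 1) j (b j)| := by
        refine (Finset.abs_sum_le_sum_abs _ _).trans (Finset.sum_le_sum fun b _ => ?_)
        rw [← mul_sub, abs_mul]
        exact mul_le_of_le_one_left (abs_nonneg _) (G.abs_utility_le_one i b)
    _ ≤ ∑ j, l1Norm (Function.update x i (Pi.single a 1) j -
          Function.update y i (Pi.single a 1) j) :=
        sum_abs_prod_sub_prod_le (update_single_mem_stdSimplex hx i a)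
          (update_single_mem_stdSimplex hy i a)
    _ ≤ _ := by
        refine Finset.sum_le_sum fun j _ => ?_
        -- The player's own factor is the same point mass on both sides; its movement is added on
        -- the right only for uniformity.
        by_cases h : j = i
        · subst h
          simpa [l1Norm] using Finset.sum_nonneg fun c _ => abs_nonneg (x j c - y j c)
        · rw [Function.update_of_ne h, Function.update_of_ne h]

end Utility

/-! ### Path length of a single player. -/

section SinglePlayer

variable {A : Type*} [Fintype A]

theorem abs_dotProduct_le_of_mem_stdSimplex {p v : A → ℝ} {c : ℝ} (hp : p ∈ stdSimplex ℝ A)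
    (hv : ∀ r, |v r| ≤ c) : |p ⬝ᵥ v| ≤ c := by
  calc |p ⬝ᵥ v| ≤ ∑ r, |p r * v r| := Finset.abs_sum_le_sum_abs _ _
    _ ≤ ∑ r, p r * c := Finset.sum_le_sum fun r _ => by
        rw [abs_mul, abs_of_nonneg (hp.1 r)]
        exact mul_le_mul_of_nonneg_left (hv r) (hp.1 r)
    _ = c := by rw [← Finset.sum_mul, hp.2, one_mul]

theorem abs_log_div_le_two_mul_sqrt {x y : A → ℝ} (hx : x ∈ openSimplex A)
    (hy : y ∈ openSimplex A) {r : A} (hr : |Real.log (y r / x r)| ≤ 1) :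
    |Real.log (y r / x r)| ≤ 2 * √(logBarrierDiv y x) := by
  have := Real.abs_le_sqrt (sq_log_div_le hx hy hr)
  rwa [Real.sqrt_mul (by norm_num), show (4 : ℝ) = 2 ^ 2 by norm_num,
    Real.sqrt_sq (by norm_num)] at this

/-- Each coordinate moves by at most `4 * √(logBarrierDiv y x)` relative to `x r`, and the weights
`x r` sum to one, so no factor of the dimension appears. -/
theorem abs_sub_dotProduct_le {x y v : A → ℝ} {c : ℝ} (hx : x ∈ openSimplex A)
    (hy : y ∈ openSimplex A) (hlog : ∀ r, |Real.log (y r / x r)| ≤ 1)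
    (hv : ∀ r, |v r| ≤ c) : |(y - x) ⬝ᵥ v| ≤ 4 * √(logBarrierDiv y x) * c := by
  have h : ∀ r, |y r - x r| ≤ x r * (4 * √(logBarrierDiv y x)) := by
    intro r
    have h1 := Real.abs_exp_sub_one_le (hlog r)
    have h2 := abs_log_div_le_two_mul_sqrt hx hy (hlog r)
    rw [Real.exp_log (div_pos (hy.2 r) (hx.2 r))] at h1
    have h3 : y r - x r = x r * (y r / x r - 1) := by
      have := (hx.2 r).ne'
      field_simp
    rw [h3, abs_mul, abs_of_pos (hx.2 r)]
    exact mul_le_mul_of_nonneg_left (by linarith) (hx.2 r).le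
  calc |(y - x) ⬝ᵥ v| ≤ ∑ r, |(y r - x r) * v r| := Finset.abs_sum_le_sum_abs _ _
    _ ≤ ∑ r, x r * (4 * √(logBarrierDiv y x)) * c := Finset.sum_le_sum fun r _ => by
        rw [abs_mul]
        exact mul_le_mul (h r) (hv r) (abs_nonneg _) ((abs_nonneg _).trans (h r))
    _ = 4 * √(logBarrierDiv y x) * c := by
        rw [← Finset.sum_mul, ← Finset.sum_mul, hx.1.2, one_mul]

/-- A point of the open simplex close to the vertex `a` on which the log-barrier exceeds its
value at `x` by at most `m log ε⁻¹`. -/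
theorem logBarrier_mix_sub_le [DecidableEq A] {x : A → ℝ} (hx : x ∈ openSimplex A) (a : A) {ε : ℝ}
    (hε : 0 < ε) (hε1 : ε ≤ 1) :
    (1 - ε) • Pi.single a 1 + ε • x ∈ openSimplex A ∧
      logBarrier ((1 - ε) • Pi.single a 1 + ε • x) - logBarrier x ≤
        Fintype.card A * Real.log ε⁻¹ := by
  have hle : ∀ r, ε * x r ≤ ((1 - ε) • Pi.single a 1 + ε • x : A → ℝ) r := fun r => by
    have h1 : (0 : ℝ) ≤ (Pi.single a 1 : A → ℝ) r := (single_mem_stdSimplex ℝ a).1 r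
    have := mul_nonneg (sub_nonneg.2 hε1) h1
    simp only [Pi.add_apply, Pi.smul_apply, smul_eq_mul]
    linarith
  have hpos : ∀ r, 0 < ε * x r := fun r => mul_pos hε (hx.2 r)
  refine ⟨⟨convex_stdSimplex ℝ A (single_mem_stdSimplex ℝ a) hx.1 (sub_nonneg.2 hε1) hε.le
    (by ring), fun r => (hpos r).trans_le (hle r)⟩, ?_⟩
  have h2 : ∀ r, Real.log (x r) ≤
      Real.log (((1 - ε) • Pi.single a 1 + ε • x : A → ℝ) r) + Real.log ε⁻¹ := fun r => by
    have := Real.log_le_log (hpos r) (hle r)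
    rw [Real.log_mul hε.ne' (hx.2 r).ne'] at this
    rw [Real.log_inv]
    linarith
  have h3 := Finset.sum_le_sum fun r (_ : r ∈ Finset.univ) => h2 r
  rw [Finset.sum_add_distrib, Finset.sum_const, Finset.card_univ, nsmul_eq_mul] at h3
  rw [logBarrier, logBarrier]
  linarith

theorem abs_log_div_le_of_isOFTRLLogBar {η : ℝ} (hη0 : 0 < η) (hη : η ≤ 1 / 128)
    {u q : ℕ → A → ℝ} {p : ℕ → ℝ} (h : IsOFTRLLogBar η (fun t => p t • u t) q)
    (hp0 : ∀ t, 0 ≤ p t) (hp1 : ∀ t, p t ≤ 1) (hu : ∀ t a, |u t a| ≤ 1) (t : ℕ) (r : A) :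
    |Real.log (q (t + 1) r / q t r)| ≤ 4 * (η * (2 * p t + p (t - 1))) := by
  have hpu : ∀ t a, |p t * u t a| ≤ p t := fun t a => by
    rw [abs_mul, abs_of_nonneg (hp0 t)]
    exact mul_le_of_le_one_right (hp0 t) (hu t a)
  refine (h.isLogBarrierLeader t).abs_log_div_le (h.isLogBarrierLeader (t + 1)) (fun a => ?_) ?_ r
  · rw [abs_mul, abs_of_pos hη0]
    refine mul_le_mul_of_nonneg_left ?_ hη0.le
    rcases t with _ | t
    · simp only [optimisticAggregate_zero, zero_add, optimisticAggregate_one, Pi.smul_apply,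
        smul_eq_mul, Pi.zero_apply, sub_zero]
      linarith [hpu 0 a, hp0 0, hp0 (0 - 1)]
    · rw [optimisticAggregate_add_two]
      simp only [Pi.add_apply, Pi.sub_apply, Pi.smul_apply, smul_eq_mul, Nat.add_sub_cancel]
      have h1 := abs_le.1 (hpu (t + 1) a)
      have h2 := abs_le.1 (hpu t a)
      exact abs_le.2 ⟨by linarith, by linarith⟩
  · nlinarith [hp1 t, hp1 (t - 1)]

/-- The swap regret against the identity map vanishes, so replacing every row of the stochastic
matrix by a perturbed vertex loses at most the perturbation. -/
theorem neg_two_mul_le_sum_mix [DecidableEq A] {Q Q₀ : Matrix A A ℝ}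
    (hQ₀ : ∀ a, Q₀ a ∈ stdSimplex ℝ A) {p u : A → ℝ} (hp : p ∈ stdSimplex ℝ A)
    (hQp : Qᵀ *ᵥ p = p) (hu : ∀ a, |u a| ≤ 1) {ε : ℝ} (hε : 0 ≤ ε) :
    -(2 * ε) ≤ ∑ a, ((1 - ε) • Pi.single a 1 + ε • Q₀ a - Q a) ⬝ᵥ (p a • u) := by
  -- Stationarity: the rows, weighted by `p`, together earn exactly what `p` earns.
  have h1 : ∑ a, p a * (Q a ⬝ᵥ u) = p ⬝ᵥ u := by
    conv_rhs => rw [← hQp]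
    rw [Matrix.mulVec_transpose, ← Matrix.dotProduct_mulVec]
    rfl
  have h2 : ∀ a, ((1 - ε) • Pi.single a 1 + ε • Q₀ a - Q a) ⬝ᵥ (p a • u) =
      p a * u a - p a * (Q a ⬝ᵥ u) + p a * (ε * (Q₀ a ⬝ᵥ u - u a)) := fun a => by
    simp only [dotProduct_smul, sub_dotProduct, add_dotProduct, smul_dotProduct,
      single_dotProduct, smul_eq_mul]
    ring
  rw [Finset.sum_congr rfl fun a _ => h2 a, Finset.sum_add_distrib, Finset.sum_sub_distrib, h1]
  have h3 : ∑ a, p a * (-(2 * ε)) ≤ ∑ a, p a * (ε * (Q₀ a ⬝ᵥ u - u a)) := by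
    refine Finset.sum_le_sum fun a _ => mul_le_mul_of_nonneg_left ?_ (hp.1 a)
    have h4 := abs_le.1 (abs_dotProduct_le_of_mem_stdSimplex (hQ₀ a) hu)
    have h5 := abs_le.1 (hu a)
    nlinarith
  rw [← Finset.sum_mul, hp.2, one_mul] at h3
  have : p ⬝ᵥ u = ∑ a, p a * u a := rfl
  linarith

theorem sum_sq_utility_variation_le {p p' : A → ℝ} (hp : p ∈ stdSimplex ℝ A) (w : ℝ) :
    ∑ a, (|p' a - p a| + p a * w) ^ 2 ≤ 2 * (l1Norm (p' - p) ^ 2 + w ^ 2) := by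
  have hp1 : ∀ a, p a ≤ 1 := fun a => by
    rw [← hp.2]
    exact Finset.single_le_sum (fun s _ => hp.1 s) (Finset.mem_univ a)
  have hE : ∀ a, |p' a - p a| ≤ l1Norm (p' - p) := fun a =>
    Finset.single_le_sum (f := fun a => |(p' - p) a|) (fun s _ => abs_nonneg _)
      (Finset.mem_univ a)
  calc ∑ a, (|p' a - p a| + p a * w) ^ 2
      ≤ ∑ a, (2 * (|p' a - p a| * l1Norm (p' - p)) + 2 * (p a * w ^ 2)) := by
        refine Finset.sum_le_sum fun a _ => ?_
        have h1 := mul_le_mul_of_nonneg_left (hE a) (abs_nonneg (p' a - p a))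
        have h2 := mul_le_mul_of_nonneg_right
          (mul_le_mul_of_nonneg_left (hp1 a) (hp.1 a)) (sq_nonneg w)
        nlinarith [sq_nonneg (|p' a - p a| - p a * w)]
    _ = 2 * (l1Norm (p' - p) ^ 2 + w ^ 2) := by
        rw [Finset.sum_add_distrib, ← Finset.mul_sum, ← Finset.mul_sum, ← Finset.sum_mul,
          ← Finset.sum_mul, hp.2]
        change 2 * (l1Norm (p' - p) * l1Norm (p' - p)) + _ = _
        ring

/-- The a priori bound `l` only keeps the perturbation small; the estimate comes from the bound of
log-ratios by `2 * √D`, with `D` the row divergence, and Cauchy–Schwarz over the rows. -/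
theorem l1Norm_sub_sq_le {Q Q' : Matrix A A ℝ} (hQ : ∀ b, Q b ∈ openSimplex A)
    (hQ' : ∀ b, Q' b ∈ openSimplex A) {p p' : A → ℝ} (hp : p ∈ stdSimplex ℝ A)
    (hQp : Qᵀ *ᵥ p = p) (hp' : p' ∈ stdSimplex ℝ A) (hQp' : Q'ᵀ *ᵥ p' = p') {l : A → ℝ}
    (hl : ∀ b c, |Real.log (Q' b c / Q b c)| ≤ l b) (hl1 : 2 * ∑ b, l b ≤ 1) :
    l1Norm (p' - p) ^ 2 ≤ 64 * Fintype.card A * ∑ b, logBarrierDiv (Q' b) (Q b) := by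
  have hl0 : ∀ b, 0 ≤ l b := fun b => (abs_nonneg _).trans (hl b b)
  have hlb : ∀ b, l b ≤ 1 := fun b => by
    have := Finset.single_le_sum (fun s _ => hl0 s) (Finset.mem_univ b)
    linarith
  have h1 := l1Norm_stationary_sub_le hQ hQ' hp hQp hp' hQp'
    (l := fun b => min (l b) (2 * √(logBarrierDiv (Q' b) (Q b))))
    (fun b c => le_min (hl b c)
      (abs_log_div_le_two_mul_sqrt (hQ b) (hQ' b) ((hl b c).trans (hlb b))))
    (le_trans (by gcongr; exact min_le_left _ _) hl1)
  have h2 : l1Norm (p' - p) ≤ 8 * ∑ b, √(logBarrierDiv (Q' b) (Q b)) := by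
    refine h1.trans ?_
    rw [show (8 : ℝ) = 4 * 2 by norm_num, mul_assoc, Finset.mul_sum _ _ (2 : ℝ)]
    gcongr
    exact min_le_right _ _
  have h0 : 0 ≤ l1Norm (p' - p) := Finset.sum_nonneg fun a _ => abs_nonneg _
  calc l1Norm (p' - p) ^ 2 ≤ (8 * ∑ b, √(logBarrierDiv (Q' b) (Q b))) ^ 2 := by gcongr
    _ = 64 * (∑ b, √(logBarrierDiv (Q' b) (Q b))) ^ 2 := by ring
    _ ≤ 64 * (Fintype.card A * ∑ b, √(logBarrierDiv (Q' b) (Q b)) ^ 2) := by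
        gcongr
        exact sq_sum_le_card_mul_sum_sq
    _ = _ := by
        rw [Finset.sum_congr rfl fun b _ => Real.sq_sqrt (logBarrierDiv_nonneg (hQ b) (hQ' b))]
        ring

/-- Bound on the second-order path length of a single player running BM-OFTRL-LogBar, in terms
of the variation `W` of the observed utilities. -/
theorem IsBMOFTRLLogBar.sum_sq_l1Norm_le [Nonempty A] {η : ℝ} (hη0 : 0 < η) (hη : η ≤ 1 / 128)
    {u x : ℕ → A → ℝ} (h : IsBMOFTRLLogBar η u x) (hu : ∀ t a, |u t a| ≤ 1) {W : ℕ → ℝ}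
    (hW : ∀ t a, |u (t + 1) a - u t a| ≤ W t) (k : ℕ) :
    (∑ t ∈ Finset.range (k + 1), l1Norm (x (t + 1) - x t) ^ 2) / (128 * Fintype.card A) ≤
      (Fintype.card A : ℝ) ^ 2 * Real.log (k + 1) + 4 * η +
        16 * η ^ 2 * ∑ t ∈ Finset.range k, (l1Norm (x (t + 1) - x t) ^ 2 + W t ^ 2) := by
  classical
  obtain ⟨Q, hQ, hx⟩ := h
  have hQs : ∀ t a, Q t a ∈ openSimplex A := fun t a => ((hQ a).isLogBarrierLeader t).mem
  have hx0 : ∀ t a, 0 ≤ x t a := fun t a => (hx t).1.1 a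
  have hxs : ∀ t, ∑ a, x t a = 1 := fun t => (hx t).1.2
  have hx1 : ∀ t a, x t a ≤ 1 := fun t a => by
    rw [← hxs t]
    exact Finset.single_le_sum (fun s _ => hx0 t s) (Finset.mem_univ a)
  have hlog : ∀ t a r, |Real.log (Q (t + 1) a r / Q t a r)| ≤
      4 * (η * (2 * x t a + x (t - 1) a)) := fun t a r =>
    abs_log_div_le_of_isOFTRLLogBar hη0 hη (hQ a) (fun t => hx0 t a) (fun t => hx1 t a) hu t r
  have hlog1 : ∀ t a r, |Real.log (Q (t + 1) a r / Q t a r)| ≤ 1 := fun t a r =>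
    (hlog t a r).trans (by nlinarith [hx1 t a, hx1 (t - 1) a])
  set D : ℕ → A → ℝ := fun t a => logBarrierDiv (Q (t + 1) a) (Q t a) with hD
  have hD0 : ∀ t a, 0 ≤ D t a := fun t a => logBarrierDiv_nonneg (hQs t a) (hQs (t + 1) a)
  have hE : ∀ t, l1Norm (x (t + 1) - x t) ^ 2 ≤ 64 * Fintype.card A * ∑ a, D t a := by
    intro t
    refine l1Norm_sub_sq_le (hQs t) (hQs (t + 1)) (hx t).1 (hx t).2 (hx (t + 1)).1
      (hx (t + 1)).2 (hlog t) ?_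
    -- The row bounds sum to `12 * η`, so twice their sum is at most `24 / 128`.
    rw [← Finset.mul_sum, ← Finset.mul_sum, Finset.sum_add_distrib, ← Finset.mul_sum, hxs, hxs]
    linarith
  set c : ℕ → A → ℝ := fun t a => |x (t + 1) a - x t a| + x t a * W t with hc
  have hgc : ∀ t a r, |(x (t + 1) a • u (t + 1) - x t a • u t) r| ≤ c t a := by
    intro t a r
    have : (x (t + 1) a • u (t + 1) - x t a • u t) r =
        (x (t + 1) a - x t a) * u (t + 1) r + x t a * (u (t + 1) r - u t r) := by
      simp only [Pi.sub_apply, Pi.smul_apply, smul_eq_mul]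
      ring
    rw [this]
    refine (abs_add_le _ _).trans (add_le_add ?_ ?_)
    · rw [abs_mul]
      exact mul_le_of_le_one_right (abs_nonneg _) (hu _ _)
    · rw [abs_mul, abs_of_nonneg (hx0 t a)]
      exact mul_le_mul_of_nonneg_left (hW t r) (hx0 t a)
  have hlin : ∀ t a, η * ((Q (t + 2) a - Q (t + 1) a) ⬝ᵥ
      (x (t + 1) a • u (t + 1) - x t a • u t)) ≤ D (t + 1) a / 2 + 8 * η ^ 2 * c t a ^ 2 := by
    intro t a
    have h1 := abs_sub_dotProduct_le (hQs (t + 1) a) (hQs (t + 2) a) (hlog1 (t + 1) a)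
      (hgc t a)
    have h2 := mul_le_mul_of_nonneg_left ((le_abs_self _).trans h1) hη0.le
    have h3 := Real.sq_sqrt (hD0 (t + 1) a)
    refine h2.trans ?_
    change η * (4 * √(D (t + 1) a) * c t a) ≤ _
    nlinarith [sq_nonneg (√(D (t + 1) a) - 4 * η * c t a)]
  -- This mixing weight costs at most `2` in regret over `k` rounds and only `log (k + 1)` per
  -- coordinate in the barrier. Mixing with `Q 0 a` compares directly with the initial barrier
  -- value.
  set ε : ℝ := ((k : ℝ) + 1)⁻¹ with hε
  have hk0 : (0 : ℝ) < k + 1 := by positivity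
  have hε0 : 0 < ε := inv_pos.2 hk0
  have hε1 : ε ≤ 1 := inv_le_one_of_one_le₀ (by linarith [Nat.cast_nonneg (α := ℝ) k])
  set y : A → A → ℝ := fun a => (1 - ε) • Pi.single a 1 + ε • Q 0 a with hy
  have hmix := fun a => logBarrier_mix_sub_le (hQs 0 a) a hε0 hε1
  have hya : ∀ a, ∑ t ∈ Finset.range (k + 1), D t a ≤
      Fintype.card A * Real.log (k + 1)
        - η * ∑ t ∈ Finset.range k, (y a - Q (t + 1) a) ⬝ᵥ (x (t + 1) a • u (t + 1))
        + η * (2 * x k a) + ∑ t ∈ Finset.range k, (D (t + 1) a / 2 + 8 * η ^ 2 * c t a ^ 2) := by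
    intro a
    have h1 := (hQ a).sum_logBarrierDiv_le (hmix a).1 k
    have h2 := (hmix a).2
    rw [hε, inv_inv] at h2
    have h3 : -(η * ((y a - Q (k + 1) a) ⬝ᵥ (x k a • u k))) ≤ η * (2 * x k a) := by
      rw [← mul_neg]
      refine mul_le_mul_of_nonneg_left ?_ hη0.le
      have h4 := abs_le.1 (abs_dotProduct_le_of_mem_stdSimplex (hmix a).1.1 (hu k))
      have h5 := abs_le.1 (abs_dotProduct_le_of_mem_stdSimplex (hQs (k + 1) a).1 (hu k))
      rw [dotProduct_smul, sub_dotProduct, smul_eq_mul]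
      have h6 := hx0 k a
      change _ ≤ y a ⬝ᵥ u k ∧ y a ⬝ᵥ u k ≤ _ at h4
      nlinarith
    have h7 := Finset.sum_le_sum fun t (_ : t ∈ Finset.range k) => hlin t a
    rw [← Finset.mul_sum] at h7
    linarith
  have hreg : ∀ t, -(2 * ε) ≤ ∑ a, (y a - Q t a) ⬝ᵥ (x t a • u t) := fun t =>
    neg_two_mul_le_sum_mix (fun a => (hQs 0 a).1) (hx t).1 (hx t).2 (hu t) hε0.le
  have hregsum : -2 ≤ ∑ a, ∑ t ∈ Finset.range k,
      (y a - Q (t + 1) a) ⬝ᵥ (x (t + 1) a • u (t + 1)) := by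
    rw [Finset.sum_comm]
    have := Finset.sum_le_sum fun t (_ : t ∈ Finset.range k) => hreg (t + 1)
    rw [Finset.sum_const, Finset.card_range, nsmul_eq_mul] at this
    have hkε : (k : ℝ) * ε ≤ 1 := by
      rw [hε, ← div_eq_mul_inv, div_le_one hk0]
      linarith
    linarith
  have hcs : ∀ t, ∑ a, c t a ^ 2 ≤ 2 * (l1Norm (x (t + 1) - x t) ^ 2 + W t ^ 2) := fun t =>
    sum_sq_utility_variation_le (hx t).1 (W t)
  set S := ∑ t ∈ Finset.range (k + 1), ∑ a, D t a with hS
  set V := ∑ t ∈ Finset.range k, (l1Norm (x (t + 1) - x t) ^ 2 + W t ^ 2) with hV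
  have hshift : ∑ t ∈ Finset.range k, ∑ a, D (t + 1) a ≤ S := by
    rw [hS, Finset.sum_range_succ']
    exact le_add_of_nonneg_right (Finset.sum_nonneg fun a _ => hD0 0 a)
  have hcV : ∑ t ∈ Finset.range k, ∑ a, c t a ^ 2 ≤ 2 * V := by
    rw [hV, Finset.mul_sum]
    exact Finset.sum_le_sum fun t _ => hcs t
  -- Of `4 * η`, one half is the last prediction term and the other the regret loss from mixing; `S
  -- / 2` comes from AM-GM in `hlin`.
  have hmain : S ≤ (Fintype.card A : ℝ) ^ 2 * Real.log (k + 1) + 4 * η + S / 2 +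
      16 * η ^ 2 * V := by
    have h1 := Finset.sum_le_sum fun a (_ : a ∈ Finset.univ) => hya a
    rw [Finset.sum_comm] at h1
    simp only [Finset.sum_add_distrib, Finset.sum_sub_distrib, Finset.sum_const,
      Finset.card_univ, nsmul_eq_mul, ← Finset.mul_sum, ← Finset.sum_div, hxs] at h1
    rw [Finset.sum_comm (s := Finset.univ) (t := Finset.range k)
        (f := fun a t => D (t + 1) a),
      Finset.sum_comm (s := Finset.univ) (t := Finset.range k) (f := fun a t => c t a ^ 2)] at h1
    have h2 := mul_le_mul_of_nonneg_left hregsum hη0.le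
    have h3 := mul_le_mul_of_nonneg_left hcV (by positivity : 0 ≤ 8 * η ^ 2)
    linarith
  have hm : (0 : ℝ) < Fintype.card A := by exact_mod_cast Fintype.card_pos
  have hES : ∑ t ∈ Finset.range (k + 1), l1Norm (x (t + 1) - x t) ^ 2 ≤
      64 * Fintype.card A * S := by
    rw [hS, Finset.mul_sum]
    exact Finset.sum_le_sum fun t _ => hE t
  rw [div_le_iff₀ (by positivity)]
  nlinarith

end SinglePlayer

end SwapLearning

/-! ### Summation over the players and absorption. -/

theorem mainTheorem1 {n : ℕ} (hn : 2 ≤ n) {A : Fin n → Type*} [∀ i, Fintype (A i)]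
    [∀ i, DecidableEq (A i)] (hA : ∀ i, 2 ≤ Fintype.card (A i))
    (G : SwapLearning.NormalFormGame n A) (η : ℝ)
    (hη : η = 1 / (128 * ((n : ℝ) - 1) * ⨆ j, Real.sqrt (Fintype.card (A j))))
    (x : ℕ → ∀ i, A i → ℝ) (hx : SwapLearning.IsBMOFTRLLogBarDynamics G η x)
    (T : ℕ) (hT : 2 ≤ T) :
    ∑ i, ∑ t ∈ Finset.Icc 1 T, SwapLearning.l1Norm (x t i - x (t - 1) i) ^ 2 ≤
      8192 * (⨆ i, (Fintype.card (A i) : ℝ)) * (∑ i, (Fintype.card (A i) : ℝ) ^ 2) *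
        Real.log T := by
  obtain ⟨k, rfl⟩ : ∃ k, T = k + 1 := ⟨T - 1, by omega⟩
  have hne : Nonempty (Fin n) := ⟨⟨0, by omega⟩⟩
  have hn1 : (1 : ℝ) ≤ (n : ℝ) - 1 := by
    have : (2 : ℝ) ≤ n := by exact_mod_cast hn
    linarith
  have hcard : ∀ i, (2 : ℝ) ≤ Fintype.card (A i) := fun i => by exact_mod_cast hA i
  set S : ℝ := ⨆ j, Real.sqrt (Fintype.card (A j)) with hS
  set M : ℝ := ⨆ i, (Fintype.card (A i) : ℝ) with hM
  have hSle : ∀ i, Real.sqrt (Fintype.card (A i)) ≤ S := fun i =>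
    le_ciSup (f := fun j => Real.sqrt (Fintype.card (A j))) (Set.finite_range _).bddAbove i
  have hMle : ∀ i, (Fintype.card (A i) : ℝ) ≤ M := fun i =>
    le_ciSup (f := fun j => (Fintype.card (A j) : ℝ)) (Set.finite_range _).bddAbove i
  have hS1 : 1 ≤ S := by
    obtain ⟨i⟩ := hne
    refine le_trans ?_ (hSle i)
    rw [Real.one_le_sqrt]
    linarith [hcard i]
  have hMS : M ≤ S ^ 2 := ciSup_le fun i => by
    rw [← Real.sq_sqrt (Nat.cast_nonneg (α := ℝ) (Fintype.card (A i)))]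
    exact pow_le_pow_left₀ (Real.sqrt_nonneg _) (hSle i) 2
  have hM0 : 0 < M := by
    obtain ⟨i⟩ := hne
    linarith [hcard i, hMle i]
  have hprod : η * ((n : ℝ) - 1) * S = 1 / 128 := by
    rw [hη]
    have : (n : ℝ) - 1 ≠ 0 := by linarith
    field_simp
  have hη0 : 0 < η := by
    rw [hη]
    have : 0 < (n : ℝ) - 1 := by linarith
    positivity
  have hη1 : η ≤ 1 / 128 := by
    rw [← hprod, mul_assoc]
    exact le_mul_of_one_le_right hη0.le (one_le_mul_of_one_le_of_one_le hn1 hS1)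
  have hηM : η ^ 2 * ((n : ℝ) - 1) ^ 2 * M ≤ 1 / 16384 := by
    calc η ^ 2 * ((n : ℝ) - 1) ^ 2 * M ≤ η ^ 2 * ((n : ℝ) - 1) ^ 2 * S ^ 2 := by gcongr
      _ = (η * ((n : ℝ) - 1) * S) ^ 2 := by ring
      _ = 1 / 16384 := by rw [hprod]; norm_num
  have hxs : ∀ t i, x t i ∈ stdSimplex ℝ (A i) := fun t i => by
    obtain ⟨Q, -, h⟩ := hx i
    exact (h t).1
  set E : ℕ → Fin n → ℝ := fun t i => SwapLearning.l1Norm (x (t + 1) i - x t i) with hE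
  have hplayer : ∀ i, (∑ t ∈ Finset.range (k + 1), E t i ^ 2) / (128 * M) ≤
      (Fintype.card (A i) : ℝ) ^ 2 * Real.log (k + 1) + 4 * η +
        16 * η ^ 2 * ∑ t ∈ Finset.range k, (E t i ^ 2 + (∑ j, E t j) ^ 2) := by
    intro i
    have hAi : Nonempty (A i) := Fintype.card_pos_iff.1 (by have := hA i; omega)
    refine le_trans ?_ ((hx i).sum_sq_l1Norm_le hη0 hη1 (W := fun t => ∑ j, E t j)
      (fun t a => G.abs_utilityVector_le_one (hxs t) i a)
      (fun t a => G.abs_utilityVector_sub_le (hxs (t + 1)) (hxs t) i a) k)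
    have := hcard i
    refine div_le_div_of_nonneg_left (Finset.sum_nonneg fun t _ => sq_nonneg _) (by linarith) ?_
    linarith [hMle i]
  set P : ℝ := ∑ i, (Fintype.card (A i) : ℝ) ^ 2 with hP
  set V : ℝ := ∑ i, ∑ t ∈ Finset.range (k + 1), E t i ^ 2 with hV
  have hV0 : 0 ≤ V := Finset.sum_nonneg fun i _ => Finset.sum_nonneg fun t _ => sq_nonneg _
  have hVlow : ∑ i, ∑ t ∈ Finset.range k, E t i ^ 2 ≤ V := by
    refine Finset.sum_le_sum fun i _ => ?_
    rw [Finset.sum_range_succ]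
    exact le_add_of_nonneg_right (sq_nonneg _)
  have hcross : ∑ t ∈ Finset.range k, (∑ j, E t j) ^ 2 ≤ n * V := by
    calc ∑ t ∈ Finset.range k, (∑ j, E t j) ^ 2
        ≤ ∑ t ∈ Finset.range k, (n : ℝ) * ∑ j, E t j ^ 2 := by
          refine Finset.sum_le_sum fun t _ => ?_
          simpa using sq_sum_le_card_mul_sum_sq (s := Finset.univ) (f := E t)
      _ = n * ∑ i, ∑ t ∈ Finset.range k, E t i ^ 2 := by
          rw [← Finset.mul_sum, Finset.sum_comm]
      _ ≤ n * V := by gcongr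
  -- Since `4 * η ≤ 1 / 32`, this lets the logarithmic term absorb the constant one.
  have hlogT : (1 : ℝ) / 32 ≤ Real.log (k + 1) := by
    have h1 : Real.log 2 ≤ Real.log (k + 1) :=
      Real.log_le_log (by norm_num) (by exact_mod_cast hT)
    linarith [Real.log_two_gt_d9]
  have hnP : (n : ℝ) ≤ P := by
    have : ∑ _i : Fin n, (1 : ℝ) ≤ P :=
      Finset.sum_le_sum fun i _ => one_le_pow₀ (by linarith [hcard i])
    simpa using this
  have hsum : V / (128 * M) ≤ 2 * (P * Real.log (k + 1)) + 16 * η ^ 2 * ((1 + (n : ℝ) ^ 2) * V) := by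
    have h1 := Finset.sum_le_sum fun i (_ : i ∈ Finset.univ) => hplayer i
    simp only [Finset.sum_add_distrib, ← Finset.mul_sum, ← Finset.sum_div, ← Finset.sum_mul,
      Finset.sum_const, Finset.card_univ, Fintype.card_fin, nsmul_eq_mul] at h1
    have h2 : (n : ℝ) * ∑ t ∈ Finset.range k, (∑ j, E t j) ^ 2 ≤ n * (n * V) := by gcongr
    have h3 : (n : ℝ) * (4 * η) ≤ P * Real.log (k + 1) :=
      mul_le_mul hnP (by linarith) (by linarith) (by linarith)
    have h4 : 16 * η ^ 2 * (∑ i, ∑ t ∈ Finset.range k, E t i ^ 2 +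
        n * ∑ t ∈ Finset.range k, (∑ j, E t j) ^ 2) ≤ 16 * η ^ 2 * ((1 + (n : ℝ) ^ 2) * V) := by
      gcongr
      linarith
    linarith
  have hfinal : V ≤ 8192 * M * P * Real.log (k + 1) := by
    rw [div_le_iff₀ (by positivity)] at hsum
    -- Equality holds at `n = 2`. With `2048 = 128 * 16`, the path length on the right then has
    -- coefficient at most `2048 * 5 / 16384 = 5 / 8`; the remaining `3 / 8` on the left would even
    -- allow the constant `2048 / 3`.
    have h1 : 1 + (n : ℝ) ^ 2 ≤ 5 * ((n : ℝ) - 1) ^ 2 := by nlinarith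
    have h2 : 2048 * (η ^ 2 * (1 + (n : ℝ) ^ 2) * M) ≤ 5 / 8 := by
      have : η ^ 2 * (1 + (n : ℝ) ^ 2) * M ≤ η ^ 2 * (5 * ((n : ℝ) - 1) ^ 2) * M := by gcongr
      linarith
    have h3 := mul_le_mul_of_nonneg_right h2 hV0
    have h4 : 0 ≤ M * (P * Real.log (k + 1)) := by
      have : 0 ≤ P := by linarith
      have : 0 ≤ Real.log (k + 1) := by linarith
      positivity
    linarith
  have hreindex : ∀ i, ∑ t ∈ Finset.Icc 1 (k + 1),
      SwapLearning.l1Norm (x t i - x (t - 1) i) ^ 2 = ∑ t ∈ Finset.range (k + 1), E t i ^ 2 := by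
    intro i
    have hIcc : Finset.Icc 1 (k + 1) = Finset.Ico (0 + 1) (k + 1 + 1) := by
      ext t
      simp only [Finset.mem_Icc, Finset.mem_Ico]
      omega
    rw [Finset.range_eq_Ico, hIcc]
    exact (Finset.sum_Ico_add' (fun t =>
      SwapLearning.l1Norm (x t i - x (t - 1) i) ^ 2) 0 (k + 1) 1).symm
  rw [Finset.sum_congr rfl fun i _ => hreindex i]
  push_cast
  exact hfinal
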